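/- Let $d\ge 1$ and $b\ge 2$ be integers. For $x\in\mathbb R\setminus\{0\}$ let $S_b(x)\in[1,b)$ be the base-$b$ significand of $x$, i.e. the unique number in $[1,b)$ with $|x|=S_b(x)\,b^k$ for some $k\in\mathbb Z$, and let $S_b(0):=0$. A real sequence $(x_n)_{n\ge 1}$ is called *$b$-Benford* if $$\lim_{N\to\infty}\frac{\#\{1\le n\le N: S_b(x_n)\le s\}}{N}=\log_b s\qquad\text{for every } s\in[1,b).$$ Let $\arg$ denote the argument with values in $(-\pi,\pi]$. A non-empty set $Z\subset\mathbb C$ contained in a circle $\{z\in\mathbb C:|z|=r\}$ with $r>0$ is called *$b$-nonresonant* if the set $$\Delta_Z:=\Bigl\{1+\frac{\arg z-\arg w}{2\pi}: z,w\in Z\Bigr\}\subset\mathbb R$$ satisfies both $\Delta_Z\cap\mathbb Q=\{1\}$ and $\log_b r\notin\operatorname{span}_{\mathbb Q}\Delta_Z$. An arbitrary set $Z\subset\mathbb C$ is *$b$-nonresonant* if, for every $r>0$, the set $Z\cap\{z\in\mathbb C:|z|=r\}$ is either empty or $b$-nonresonant. For $A\in\mathbb R^{d\times d}$ let $\sigma(A)\subset\mathbb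 C$ be the set of its (complex) eigenvalues. Let $|x|$ be the Euclidean norm of $x\in\mathbb R^d$ and $|A|=\max\{|Ax|:|x|=1\}$ the spectral norm of $A$. **Corollary 3.11.** Let $A\in\mathbb R^{d\times d}$ be invertible and assume that $\sigma(A)$ is $b$-nonresonant. Then: 1. For every $x,y\in\mathbb R^d$ the sequence $(x^\top A^n y)$ is $b$-Benford or identically zero. 2. For every $x\in\mathbb R^d\setminus\{0\}$ the sequence $(|A^n x|)$ is $b$-Benford. 3. The sequence $(|A^n|)$ is $b$-Benford. -/

import Mathlib

open Filter Topology

noncomputable section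

namespace BenfordLinear

/-- The base-`b` significand: for `x ≠ 0` the unique number in `[1, b)` with
`|x| = significand b x * b ^ k` for some integer `k`; it is `0` at `x = 0`. -/
def significand (b : ℕ) (x : ℝ) : ℝ :=
  if x = 0 then 0 else (b : ℝ) ^ (Real.logb b |x| - (⌊Real.logb b |x|⌋ : ℝ))

/-- A real sequence `(x n)`, indexed by the positive integers (the value `x 0` is ignored),
is `b`-Benford if for every `s ∈ [1, b)` the set of `n` with `significand b (x n) ≤ s` has
natural density `log_b s`. -/
def IsBenford (b : ℕ) (x : ℕ → ℝ) : Prop :=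
  ∀ s : ℝ, 1 ≤ s → s < b →
    Tendsto (fun N : ℕ =>
        (((Finset.Icc 1 N).filter (fun n => significand b (x n) ≤ s)).card : ℝ) / (N : ℝ))
      atTop (𝓝 (Real.logb b s))

/-- The set of the numbers `1 + (arg z - arg w) / (2π)` with `z, w ∈ Z`, where
`arg` takes its values in `(-π, π]`. -/
def argDifferences (Z : Set ℂ) : Set ℝ :=
  {t : ℝ | ∃ z ∈ Z, ∃ w ∈ Z, t = 1 + (Complex.arg z - Complex.arg w) / (2 * Real.pi)}

/-- `b`-nonresonance of a non-empty set `Z` contained in the circle `|z| = r`. -/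
def IsNonresonantOnCircle (b : ℕ) (r : ℝ) (Z : Set ℂ) : Prop :=
  Z.Nonempty ∧ (∀ z ∈ Z, ‖z‖ = r) ∧
    argDifferences Z ∩ Set.range (fun q : ℚ => (q : ℝ)) = {1} ∧
    Real.logb b r ∉ Submodule.span ℚ (argDifferences Z)

/-- An arbitrary set `Z` of complex numbers is `b`-nonresonant if its intersection with each
circle of radius `r > 0` about the origin is `b`-nonresonant or empty. -/
def IsNonresonant (b : ℕ) (Z : Set ℂ) : Prop :=
  ∀ r : ℝ, 0 < r →
    IsNonresonantOnCircle b r (Z ∩ {z : ℂ | ‖z‖ = r}) ∨ Z ∩ {z : ℂ | ‖z‖ = r} = ∅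

/-- The spectrum of a real square matrix: the set of its complex eigenvalues. -/
def complexSpectrum {d : ℕ} (A : Matrix (Fin d) (Fin d) ℝ) : Set ℂ :=
  spectrum ℂ (A.map (algebraMap ℝ ℂ))

/-- The Euclidean norm of a vector. -/
def euclideanNorm {d : ℕ} (x : Fin d → ℝ) : ℝ :=
  ‖(WithLp.toLp 2 x : EuclideanSpace ℝ (Fin d))‖

/-- The spectral norm of a matrix: the operator norm induced by the Euclidean norm. -/
def matrixNorm {d : ℕ} (A : Matrix (Fin d) (Fin d) ℝ) : ℝ :=
  ‖Matrix.toEuclideanCLM (n := Fin d) (𝕜 := ℝ) A‖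

end BenfordLinear

end

noncomputable section

namespace BenfordLinear

open MeasureTheory

/-! A sequence is Benford once the averages of `e(h log_b |x n|)` vanish for every integer `h ≠ 0`,
where `e(t) = exp(2πit)` (Weyl, `isBenford_of_weyl`). All three claims concern norms of `L (A ^ n)`
for a complex-linear map `L`. By `exists_pow_eq_sum`, `L (A ^ n)` is a finite combination of
`n.choose i * z ^ n` with `z` an eigenvalue and vector coefficients. If some coefficient is nonzero,
the terms of largest modulus `r`, and among them of largest `i = k`, dominate: `L (A ^ n) = r ^ n *
n.choose k * (F n + o(1))` with `F n = ∑ e(n θ j) c j`, `θ j` being `arg z / 2π`.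

So `e(h log_b ‖L (A ^ n)‖)` is close to a product of three factors: the geometric `e(n h log_b r)`,
the slowly varying `e(h log_b (n.choose k))`, and a function of the torus point `n θ`, continuous
where `F` does not vanish. Approximating the last by characters leaves averages of a slow weight
times `e(n (h log_b r + ∑ m j θ j))`, which vanish by summation by parts unless that frequency is an
integer (`tendsto_avg_torusOrbit`). Since the spectrum is closed under conjugation, each `θ j` lies
in the rational span of the argument differences, so nonresonance excludes integers.

The zeros of `F` are harmless because `F n` is rarely small (`exists_card_norm_lt_le`). This uses
the other half of nonresonance: ratios of distinct eigenvalues of equal modulus are not roots of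
unity. -/

/-! ### Weyl's criterion and the Benford property -/

/-- Uniformly bounded linear functionals that tend to zero on a set with dense span tend to
zero everywhere. -/
theorem tendsto_zero_of_dense_span {E : Type*} [NormedAddCommGroup E] [NormedSpace ℂ E]
    (L : ℕ → E →ₗ[ℂ] ℂ) (C : ℝ) (hL : ∀ N f, ‖L N f‖ ≤ C * ‖f‖) (S : Set E)
    (hS : (Submodule.span ℂ S).topologicalClosure = ⊤)
    (h : ∀ f ∈ S, Tendsto (fun N => L N f) atTop (𝓝 0)) (f : E) :
    Tendsto (fun N => L N f) atTop (𝓝 0) := by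
  have hspan : ∀ f ∈ Submodule.span ℂ S, Tendsto (fun N => L N f) atTop (𝓝 0) := by
    intro f hf
    induction hf using Submodule.span_induction with
    | mem x hx => exact h x hx
    | zero => simp
    | add x y _ _ hx hy => simpa using hx.add hy
    | smul a x _ hx => simpa using hx.const_mul a
  have hf : f ∈ closure (Submodule.span ℂ S : Set E) := by
    rw [← Submodule.topologicalClosure_coe, hS]; trivial
  rw [Metric.tendsto_atTop]
  intro ε hε
  have hC : 0 < |C| + 1 := by positivity
  obtain ⟨g, hg, hfg⟩ := Metric.mem_closure_iff.1 hf (ε / 2 / (|C| + 1)) (by positivity)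
  obtain ⟨N₀, hN₀⟩ := Metric.tendsto_atTop.1 (hspan g hg) (ε / 2) (by positivity)
  refine ⟨N₀, fun N hN => ?_⟩
  have h1 := hN₀ N hN
  rw [dist_zero_right] at h1 ⊢
  have h2 : ‖L N (f - g)‖ < ε / 2 := by
    refine (hL N _).trans_lt ?_
    rw [dist_eq_norm, lt_div_iff₀ hC] at hfg
    nlinarith [le_abs_self C, norm_nonneg (f - g)]
  calc ‖L N f‖ = ‖L N (f - g) + L N g‖ := by rw [← map_add, sub_add_cancel]
    _ ≤ _ := norm_add_le _ _
    _ < ε := by linarith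

/-- The normalized sums `(N+1)⁻¹ ∑_{n ≤ N} f (p n)`, minus the mean of `f`. -/
def discrepancy {X : Type*} [TopologicalSpace X] [CompactSpace X] [MeasurableSpace X]
    [OpensMeasurableSpace X] (μ : Measure X) [IsFiniteMeasure μ] (p : ℕ → X) (N : ℕ) :
    C(X, ℂ) →ₗ[ℂ] ℂ where
  toFun f := ((N + 1 : ℕ) : ℂ)⁻¹ * ∑ n ∈ Finset.range (N + 1), f (p n) - ∫ x, f x ∂μ
  map_add' f g := by
    have hf : ∀ f : C(X, ℂ), Integrable f μ := fun f =>
      f.continuous.integrable_of_hasCompactSupport (HasCompactSupport.of_compactSpace _)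
    simp only [ContinuousMap.add_apply, Finset.sum_add_distrib]
    rw [integral_add (hf f) (hf g)]; ring
  map_smul' c f := by
    simp only [ContinuousMap.smul_apply, smul_eq_mul, ← Finset.mul_sum, integral_const_mul,
      RingHom.id_apply]
    ring

theorem norm_avg_le {u : ℕ → ℂ} {C : ℝ} (hu : ∀ n, ‖u n‖ ≤ C) (N : ℕ) :
    ‖(N : ℂ)⁻¹ * ∑ n ∈ Finset.range N, u n‖ ≤ C := by
  have hC : 0 ≤ C := (norm_nonneg _).trans (hu 0)
  rcases Nat.eq_zero_or_pos N with rfl | hN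
  · simpa using hC
  have hN' : (0 : ℝ) < N := by exact_mod_cast hN
  rw [norm_mul, norm_inv, Complex.norm_natCast, inv_mul_le_iff₀ hN']
  refine (norm_sum_le _ _).trans ((Finset.sum_le_sum fun n _ => hu n).trans ?_)
  simp

/-- Weyl's criterion, in terms of continuous functions on the circle. -/
theorem tendsto_avg_continuousMap {y : ℕ → ℝ}
    (h : ∀ m : ℤ, m ≠ 0 → Tendsto (fun N : ℕ => (N : ℂ)⁻¹ *
      ∑ n ∈ Finset.range N, fourier m (y n : UnitAddCircle)) atTop (𝓝 0))
    (f : C(UnitAddCircle, ℂ)) :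
    Tendsto (fun N : ℕ => ((N + 1 : ℕ) : ℂ)⁻¹ *
      ∑ n ∈ Finset.range (N + 1), f (y n : UnitAddCircle)) atTop
      (𝓝 (∫ x : UnitAddCircle, f x)) := by
  rw [← tendsto_sub_nhds_zero_iff]
  refine tendsto_zero_of_dense_span
    (fun N => discrepancy volume (fun n => (y n : UnitAddCircle)) N) 2 ?_ _
    span_fourier_closure_eq_top ?_ f
  · intro N f
    -- The average and the integral are each at most `‖f‖`, whence the constant 2.
    have h1 := norm_avg_le (fun n => f.norm_coe_le_norm (y n : UnitAddCircle)) (N + 1)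
    have h2 : ‖∫ x : UnitAddCircle, f x‖ ≤ ‖f‖ := by
      simpa [Measure.real, UnitAddCircle.measure_univ] using
        norm_integral_le_of_norm_le_const (μ := (volume : Measure UnitAddCircle))
          (Eventually.of_forall f.norm_coe_le_norm)
    exact (norm_sub_le _ _).trans (by linarith)
  · rintro _ ⟨m, rfl⟩
    change Tendsto (fun N : ℕ => ((N + 1 : ℕ) : ℂ)⁻¹ *
      ∑ n ∈ Finset.range (N + 1), fourier m (y n : UnitAddCircle) -
        ∫ x : UnitAddCircle, fourier m x) atTop (𝓝 0)
    have hint : ∫ x : UnitAddCircle, fourier m x = if m = 0 then (1 : ℂ) else 0 := by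
      have := congrFun (fourierCoeff_fourier (T := (1 : ℝ)) m) 0
      simp only [fourierCoeff, neg_zero, fourier_zero, one_smul] at this
      rw [AddCircle.volume_eq_smul_haarAddCircle, ENNReal.ofReal_one, one_smul, this]
      simp [Pi.single_apply, eq_comm]
    rw [hint]
    split_ifs with hm
    · subst hm
      refine tendsto_const_nhds.congr fun N => ?_
      have : ((N + 1 : ℕ) : ℂ) ≠ 0 := by exact_mod_cast N.succ_ne_zero
      simp only [fourier_zero, Finset.sum_const, Finset.card_range, nsmul_eq_mul, mul_one]
      rw [inv_mul_cancel₀ this, sub_self]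
    · simpa using (tendsto_add_atTop_iff_nat 1).2 (h m hm)

/-- The arc of the circle formed by the classes of the numbers in `[0, a]`. -/
def arc (a : ℝ) : Set UnitAddCircle := (fun x : ℝ => (x : UnitAddCircle)) '' Set.Icc 0 a

theorem coe_mem_arc_iff {a : ℝ} (ha : a < 1) (y : ℝ) :
    (y : UnitAddCircle) ∈ arc a ↔ Int.fract y ≤ a := by
  have hfr : ((Int.fract y : ℝ) : UnitAddCircle) = (y : UnitAddCircle) := by
    have : ((Int.fract y : ℝ) : UnitAddCircle) = ((y - ⌊y⌋ : ℝ) : UnitAddCircle) := rfl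
    rw [this, AddCircle.coe_sub, sub_eq_self]
    exact (AddCircle.coe_eq_zero_iff 1).2 ⟨⌊y⌋, by simp⟩
  constructor
  · rintro ⟨x, ⟨hx0, hxa⟩, hxy⟩
    have hxy' : (x : UnitAddCircle) = ((Int.fract y : ℝ) : UnitAddCircle) := hxy.trans hfr.symm
    rw [AddCircle.coe_eq_coe_iff_of_mem_Ico (a := 0) ⟨hx0, by linarith⟩
      ⟨Int.fract_nonneg y, by linarith [Int.fract_lt_one y]⟩] at hxy'
    exact hxy' ▸ hxa
  · exact fun h => ⟨Int.fract y, ⟨Int.fract_nonneg y, h⟩, hfr⟩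

theorem isClosed_arc (a : ℝ) : IsClosed (arc a) :=
  (isCompact_Icc.image (AddCircle.continuous_mk' 1)).isClosed

/-- The quotient map is open, so only the two endpoints can be frontier points. Weak convergence of
measures then yields convergence on the arc. -/
theorem volume_frontier_arc (a : ℝ) : volume (frontier (arc a)) = 0 := by
  have hpt : ∀ x : UnitAddCircle, volume {x} = 0 := fun x => by
    rw [← Metric.closedBall_zero, AddCircle.volume_closedBall]; simp
  refine measure_mono_null (t := {((0 : ℝ) : UnitAddCircle)} ∪ {(a : UnitAddCircle)}) ?_
    (measure_union_null (hpt _) (hpt _))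
  rw [(isClosed_arc a).frontier_eq]
  rintro _ ⟨⟨x, ⟨hx0, hxa⟩, rfl⟩, hx⟩
  by_contra hne
  simp only [Set.mem_union, Set.mem_singleton_iff, not_or] at hne
  have h0 : 0 < x := lt_of_le_of_ne hx0 (by rintro rfl; exact hne.1 rfl)
  have h1 : x < a := lt_of_le_of_ne hxa (by rintro rfl; exact hne.2 rfl)
  apply hx
  have hop : IsOpen ((fun x : ℝ => (x : UnitAddCircle)) '' Set.Ioo 0 a) :=
    QuotientAddGroup.isOpenMap_coe _ isOpen_Ioo
  exact interior_maximal (Set.image_mono Set.Ioo_subset_Icc_self) hop ⟨x, ⟨h0, h1⟩, rfl⟩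

theorem volume_arc {a : ℝ} (ha0 : 0 ≤ a) (ha1 : a < 1) : volume (arc a) = ENNReal.ofReal a := by
  rw [AddCircle.add_projection_respects_measure 1 0 (isClosed_arc a).measurableSet]
  -- In the fundamental domain `(0, 1]` the class of 0 is represented by 1, which adds a null point.
  have : (QuotientAddGroup.mk ⁻¹' arc a ∩ Set.Ioc 0 (0 + 1) : Set ℝ) =
      Set.Ioc 0 a ∪ {1} := by
    ext x
    have := coe_mem_arc_iff ha1 x
    simp only [Set.mem_inter_iff, Set.mem_preimage, Set.mem_Ioc, Set.mem_union,
      Set.mem_singleton_iff, zero_add]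
    change (x : UnitAddCircle) ∈ arc a ∧ _ ↔ _
    rw [this]
    constructor
    · rintro ⟨h, h0, h1⟩
      rcases h1.lt_or_eq with h1 | h1
      · rw [Int.fract_eq_self.2 ⟨h0.le, h1⟩] at h
        exact Or.inl ⟨h0, h⟩
      · exact Or.inr h1
    · rintro (⟨h0, h1⟩ | rfl)
      · rw [Int.fract_eq_self.2 ⟨h0.le, h1.trans_lt ha1⟩]
        exact ⟨h1, h0, h1.trans ha1.le⟩
      · simpa using ha0
  rw [this, measure_union (by simp [ha1]) (measurableSet_singleton _)]
  simp

instance : IsProbabilityMeasure (volume : Measure UnitAddCircle) := ⟨UnitAddCircle.measure_univ⟩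

/-- The empirical distribution of the first `N + 1` terms of a sequence. -/
def empirical {X : Type*} [MeasurableSpace X] (p : ℕ → X) (N : ℕ) : Measure X :=
  ((N + 1 : ℕ) : ENNReal)⁻¹ • ∑ n ∈ Finset.range (N + 1), Measure.dirac (p n)

theorem empirical_apply {X : Type*} [MeasurableSpace X] (p : ℕ → X) (N : ℕ) {s : Set X}
    [DecidablePred (· ∈ s)] (hs : MeasurableSet s) :
    empirical p N s =
      ((N + 1 : ℕ) : ENNReal)⁻¹ * ((Finset.range (N + 1)).filter fun n => p n ∈ s).card := by
  simp only [empirical, Measure.smul_apply, Measure.finsetSum_apply, smul_eq_mul,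
    Measure.dirac_apply' _ hs, Finset.card_filter, Nat.cast_sum, Set.indicator_apply]
  simp

instance {X : Type*} [MeasurableSpace X] (p : ℕ → X) (N : ℕ) :
    IsProbabilityMeasure (empirical p N) := by
  classical
  refine ⟨?_⟩
  rw [empirical_apply p N MeasurableSet.univ]
  simp only [Set.mem_univ, Finset.filter_true, Finset.card_range]
  exact ENNReal.inv_mul_cancel (by simp) (by simp)

theorem integral_empirical {X : Type*} [TopologicalSpace X] [CompactSpace X] [MeasurableSpace X]
    [OpensMeasurableSpace X] (p : ℕ → X) (N : ℕ) (f : C(X, ℂ)) :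
    ∫ x, f x ∂(empirical p N) =
      ((N + 1 : ℕ) : ℂ)⁻¹ * ∑ n ∈ Finset.range (N + 1), f (p n) := by
  rw [empirical, integral_smul_measure, integral_finsetSum_measure]
  · have hN : ((N : ENNReal) + 1).toReal = N + 1 := by
      rw [ENNReal.toReal_add (by simp) (by simp)]; simp
    simp [integral_dirac' _ _ f.continuous.stronglyMeasurable, hN]
  · exact fun n _ => f.continuous.integrable_of_hasCompactSupport
      (HasCompactSupport.of_compactSpace _)

/-- Weyl's criterion for uniform distribution modulo one. -/
theorem tendsto_card_fract_le {y : ℕ → ℝ}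
    (h : ∀ m : ℤ, m ≠ 0 → Tendsto (fun N : ℕ => (N : ℂ)⁻¹ *
      ∑ n ∈ Finset.range N, fourier m (y n : UnitAddCircle)) atTop (𝓝 0))
    {a : ℝ} (ha0 : 0 ≤ a) (ha1 : a < 1) :
    Tendsto (fun N : ℕ => (((Finset.range N).filter fun n => Int.fract (y n) ≤ a).card : ℝ) / N)
      atTop (𝓝 a) := by
  classical
  set p : ℕ → UnitAddCircle := fun n => (y n : UnitAddCircle)
  -- Taking `N + 1` terms makes this a probability measure even for `N = 0`.
  let P : ℕ → ProbabilityMeasure UnitAddCircle := fun N => ⟨empirical p N, inferInstance⟩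
  let P' : ProbabilityMeasure UnitAddCircle := ⟨volume, inferInstance⟩
  have hw : Tendsto P atTop (𝓝 P') := by
    rw [ProbabilityMeasure.tendsto_iff_forall_integral_rclike_tendsto ℂ]
    intro f
    have := tendsto_avg_continuousMap h f.toContinuousMap
    refine this.congr fun N => ?_
    exact (integral_empirical p N f.toContinuousMap).symm
  have h1 := ProbabilityMeasure.tendsto_measure_of_null_frontier_of_tendsto' hw
    (E := arc a) (volume_frontier_arc a)
  change Tendsto (fun N => empirical p N (arc a)) atTop (𝓝 (volume (arc a))) at h1
  rw [volume_arc ha0 ha1] at h1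
  have h2 := (ENNReal.tendsto_toReal ENNReal.ofReal_ne_top).comp h1
  rw [ENNReal.toReal_ofReal ha0] at h2
  rw [← tendsto_add_atTop_iff_nat 1]
  refine h2.congr fun N => ?_
  simp only [Function.comp_apply]
  rw [empirical_apply p N (isClosed_arc a).measurableSet]
  have hN : ((N : ENNReal) + 1).toReal = N + 1 := by
    rw [ENNReal.toReal_add (by simp) (by simp)]; simp
  simp only [p, coe_mem_arc_iff ha1]
  simp [div_eq_inv_mul, hN]

theorem significand_le_iff {b : ℕ} (hb : 2 ≤ b) {s : ℝ} (hs : 1 ≤ s) (x : ℝ) :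
    significand b x ≤ s ↔ Int.fract (Real.logb b |x|) ≤ Real.logb b s := by
  have hb1 : (1 : ℝ) < b := by exact_mod_cast hb
  unfold significand
  split_ifs with hx
  -- With `logb b 0 = 0`, both sides hold at zero.
  · subst hx
    simp only [abs_zero, Real.logb_zero, Int.fract_zero]
    exact iff_of_true (by linarith) (Real.logb_nonneg hb1 hs)
  · rw [Real.le_logb_iff_rpow_le hb1 (by linarith)]; rfl

/-- The Benford property follows from the vanishing of the exponential averages of the
logarithms. -/
theorem isBenford_of_weyl {b : ℕ} (hb : 2 ≤ b) {x : ℕ → ℝ}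
    (h : ∀ m : ℤ, m ≠ 0 → Tendsto (fun N : ℕ => (N : ℂ)⁻¹ *
      ∑ n ∈ Finset.range N, fourier m (Real.logb b |x n| : UnitAddCircle)) atTop (𝓝 0)) :
    IsBenford b x := by
  intro s hs1 hsb
  have hb1 : (1 : ℝ) < b := by exact_mod_cast hb
  have ha0 : 0 ≤ Real.logb b s := Real.logb_nonneg hb1 hs1
  have ha1 : Real.logb b s < 1 := by
    rw [Real.logb_lt_iff_lt_rpow hb1 (by linarith)]; simpa using hsb
  -- The Benford count runs over `1, …, N` and the averages over `0, …, N - 1`; the shift costs a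
  -- boundary term of norm at most `2 / N`.
  have key := tendsto_card_fract_le (y := fun n => Real.logb b |x (n + 1)|) (fun m hm => by
    have h1 := h m hm
    have h2 : Tendsto (fun N : ℕ => (N : ℂ)⁻¹ * (fourier m (Real.logb b |x N| : UnitAddCircle)
        - fourier m (Real.logb b |x 0| : UnitAddCircle))) atTop (𝓝 0) := by
      refine squeeze_zero_norm (a := fun N : ℕ => (N : ℝ)⁻¹ * 2) (fun N => ?_) ?_
      · rw [norm_mul, norm_inv, Complex.norm_natCast]
        refine mul_le_mul_of_nonneg_left ((norm_sub_le _ _).trans ?_) (by positivity)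
        have hn : ∀ z : UnitAddCircle, ‖fourier m z‖ = 1 := fun z => by
          rw [fourier_apply]; exact Circle.norm_coe _
        rw [hn, hn]; norm_num
      · simpa using (tendsto_inv_atTop_nhds_zero_nat (𝕜 := ℝ)).mul_const 2
    have h3 := h1.add h2
    rw [add_zero] at h3
    refine h3.congr fun N => ?_
    rw [← mul_add]
    congr 1
    have := Finset.sum_range_succ
      (fun n => fourier m (Real.logb b |x n| : UnitAddCircle)) N
    rw [Finset.sum_range_succ'] at this
    linear_combination -this) ha0 ha1
  refine key.congr fun N => ?_
  congr 2
  simp only [significand_le_iff hb hs1]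
  refine Finset.card_bij (fun n _ => n + 1) ?_ ?_ ?_
  · intro n hn
    simp only [Finset.mem_filter, Finset.mem_range, Finset.mem_Icc] at hn ⊢
    exact ⟨⟨by lia, by lia⟩, hn.2⟩
  · intro n _ n' _ h; lia
  · intro n hn
    simp only [Finset.mem_filter, Finset.mem_range, Finset.mem_Icc] at hn ⊢
    refine ⟨n - 1, ⟨by lia, ?_⟩, by lia⟩
    rw [Nat.sub_add_cancel hn.1.1]; exact hn.2

/-! ### Exponential sums are rarely small -/

/-- A set of integers consists of points that are followed by a gap of length `H`, which are
rare, and of points `n` for which `n + h` is in the set for some `1 ≤ h ≤ H`. -/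
theorem card_filter_range_le_gap (E : ℕ → Prop) [DecidablePred E] (H N : ℕ) :
    ((Finset.range N).filter E).card ≤ N / (H + 1) + 1 +
      ∑ h ∈ Finset.Icc 1 H, ((Finset.range N).filter fun n => E n ∧ E (n + h)).card := by
  classical
  set S := (Finset.range N).filter fun n => E n ∧ ∀ h ∈ Finset.Icc 1 H, ¬ E (n + h) with hS
  have hsub : (Finset.range N).filter E ⊆ S ∪
      (Finset.Icc 1 H).biUnion fun h => (Finset.range N).filter fun n => E n ∧ E (n + h) := by
    intro n hn
    simp only [hS, Finset.mem_union, Finset.mem_biUnion, Finset.mem_filter] at hn ⊢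
    by_cases h : ∃ h ∈ Finset.Icc 1 H, E (n + h)
    · obtain ⟨h, hh, hE⟩ := h
      exact Or.inr ⟨h, hh, hn.1, hn.2, hE⟩
    · push Not at h
      exact Or.inl ⟨hn.1, hn.2, h⟩
  -- Distinct points of `S` differ by more than `H`, so each block of length `H + 1` contains at
  -- most one.
  have hcard : S.card ≤ N / (H + 1) + 1 := by
    rw [← Finset.card_range (N / (H + 1) + 1)]
    refine Finset.card_le_card_of_injOn (fun n => n / (H + 1)) ?_ ?_
    · intro n hn
      simp only [hS, Finset.coe_filter, Finset.mem_range, Set.mem_ofPred_eq] at hn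
      simp only [Finset.coe_range, Set.mem_Iio]
      exact Nat.lt_succ_of_le (Nat.div_le_div_right hn.1.le)
    · have key : ∀ n ∈ S, ∀ m ∈ S, n / (H + 1) = m / (H + 1) → ¬ n < m := by
        intro n hn m hm hnm hlt
        simp only [hS, Finset.mem_filter] at hn hm
        have h1 := Nat.div_add_mod n (H + 1)
        have h2 := Nat.div_add_mod m (H + 1)
        have h3 := Nat.mod_lt m (Nat.succ_pos H)
        rw [hnm] at h1
        refine hn.2.2 (m - n) (Finset.mem_Icc.2 ⟨by lia, by lia⟩) ?_
        rw [Nat.add_sub_cancel' hlt.le]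
        exact hm.2.1
      intro n hn m hm hnm
      have h1 := key n hn m hm hnm
      have h2 := key m hm n hn hnm.symm
      lia
  refine (Finset.card_le_card hsub).trans ((Finset.card_union_le _ _).trans ?_)
  exact add_le_add hcard Finset.card_biUnion_le

/-- An exponential sum whose frequencies have pairwise ratios that are not roots of unity is
rarely small. -/
theorem exists_card_norm_lt_le {ι : Type*} {z : ι → ℂ} (hz : ∀ j, ‖z j‖ = 1)
    {s : Finset ι} (hs : s.Nonempty)
    (hzz : ∀ j ∈ s, ∀ k ∈ s, j ≠ k → ∀ h : ℕ, 1 ≤ h → z j ^ h ≠ z k ^ h) (c : ι → ℂ)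
    (hc : ∀ j ∈ s, c j ≠ 0) {δ : ℝ} (hδ : 0 < δ) :
    ∃ η > 0, ∀ᶠ N : ℕ in atTop,
      (((Finset.range N).filter fun n => ‖∑ j ∈ s, c j * z j ^ n‖ < η).card : ℝ) ≤ δ * N := by
  classical
  induction hs using Finset.Nonempty.cons_induction generalizing c δ with
  | singleton a =>
    refine ⟨‖c a‖, norm_pos_iff.2 (hc a (Finset.mem_singleton_self a)),
      Eventually.of_forall fun N => ?_⟩
    simp only [Finset.sum_singleton, norm_mul, norm_pow, hz, one_pow, mul_one, lt_irrefl,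
      Finset.filter_false, Finset.card_empty, Nat.cast_zero]
    positivity
  | cons m s hm hs ih =>
    have hne : ∀ j ∈ s, m ≠ j := fun j hj h => hm (h ▸ hj)
    -- Three contributions of `δ / 3 * N` each: points followed by a gap, at most about `N / H`; the
    -- extra 1, once `N ≥ 3 / δ`; and `H` shifts at `δ / (3 * H) * N` each.
    obtain ⟨H, hH⟩ := exists_nat_gt (3 / δ)
    have hH1 : (0 : ℝ) < H := (by positivity : (0 : ℝ) < 3 / δ).trans hH
    -- If `f n` and `f (n + h)` are both small, so is `f (n + h) - z m ^ h * f n`. There the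
    -- frequency `z m` cancels and the other coefficients stay nonzero, so induction applies.
    have step : ∀ h : ℕ, 1 ≤ h → ∃ η > 0, ∀ᶠ N : ℕ in atTop, (((Finset.range N).filter fun n =>
        ‖∑ j ∈ s, (c j * (z j ^ h - z m ^ h)) * z j ^ n‖ < η).card : ℝ) ≤ δ / (3 * H) * N := by
      intro h hh
      refine ih (fun j hj k hk => hzz j (Finset.mem_cons_of_mem hj) k (Finset.mem_cons_of_mem hk))
        _ (fun j hj => mul_ne_zero (hc j (Finset.mem_cons_of_mem hj)) (sub_ne_zero.2 ?_))
        (by positivity)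
      exact hzz j (Finset.mem_cons_of_mem hj) m (Finset.mem_cons_self m s) (hne j hj).symm h hh
    choose! η hη0 hη using step
    have hη' : ∃ η₀ > 0, ∀ h ∈ Finset.Icc 1 H, 2 * η₀ ≤ η h := by
      rcases (Finset.Icc 1 H).eq_empty_or_nonempty with he | hne
      · exact ⟨1, one_pos, by simp [he]⟩
      · obtain ⟨h₀, hh₀, hmin⟩ := Finset.exists_min_image _ η hne
        refine ⟨η h₀ / 2, half_pos (hη0 h₀ (Finset.mem_Icc.1 hh₀).1), fun h hh => ?_⟩
        linarith [hmin h hh]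
    obtain ⟨η₀, hη₀, hle⟩ := hη'
    refine ⟨η₀, hη₀, ?_⟩
    have hall : ∀ᶠ N : ℕ in atTop, ∀ h ∈ Finset.Icc 1 H, (((Finset.range N).filter fun n =>
        ‖∑ j ∈ s, (c j * (z j ^ h - z m ^ h)) * z j ^ n‖ < η h).card : ℝ) ≤ δ / (3 * H) * N :=
      (Finset.eventually_all _).2 fun h hh => hη h (Finset.mem_Icc.1 hh).1
    filter_upwards [hall, eventually_ge_atTop ⌈3 / δ⌉₊] with N hN hN1
    set f : ℕ → ℂ := fun n => ∑ j ∈ Finset.cons m s hm, c j * z j ^ n with hf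
    have hfs : ∀ n h, f (n + h) - z m ^ h * f n =
        ∑ j ∈ s, (c j * (z j ^ h - z m ^ h)) * z j ^ n := by
      intro n h
      simp only [hf, Finset.sum_cons, mul_add, Finset.mul_sum]
      rw [add_sub_add_comm, ← Finset.sum_sub_distrib]
      have : c m * z m ^ (n + h) - z m ^ h * (c m * z m ^ n) = 0 := by ring
      rw [this, zero_add]
      exact Finset.sum_congr rfl fun j _ => by ring
    have hgap := card_filter_range_le_gap (fun n => ‖f n‖ < η₀) H N
    have hterm : ∀ h ∈ Finset.Icc 1 H,
        (((Finset.range N).filter fun n => ‖f n‖ < η₀ ∧ ‖f (n + h)‖ < η₀).card : ℝ) ≤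
          δ / (3 * H) * N := by
      intro h hh
      refine le_trans ?_ (hN h hh)
      norm_cast
      refine Finset.card_le_card fun n hn => ?_
      simp only [Finset.mem_filter] at hn ⊢
      refine ⟨hn.1, ?_⟩
      rw [← hfs]
      calc _ ≤ ‖f (n + h)‖ + ‖z m ^ h * f n‖ := norm_sub_le _ _
        _ = ‖f (n + h)‖ + ‖f n‖ := by rw [norm_mul, norm_pow, hz, one_pow, one_mul]
        _ < η h := by linarith [hn.2.1, hn.2.2, hle h hh]
    have hN1' : 3 / δ ≤ N := (Nat.le_ceil _).trans (by exact_mod_cast hN1)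
    have e1 : (1 : ℝ) ≤ δ / 3 * N := by
      rw [div_le_iff₀ hδ] at hN1'; linarith
    have e2 : ((N / (H + 1) : ℕ) : ℝ) ≤ δ / 3 * N := by
      refine Nat.cast_div_le.trans ?_
      rw [div_le_iff₀ (by positivity)]
      rw [div_lt_iff₀ hδ] at hH
      push_cast
      have : (0 : ℝ) ≤ N := N.cast_nonneg
      nlinarith [mul_nonneg this hδ.le]
    have e3 : ∑ h ∈ Finset.Icc 1 H,
        (((Finset.range N).filter fun n => ‖f n‖ < η₀ ∧ ‖f (n + h)‖ < η₀).card : ℝ) ≤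
          δ / 3 * N := by
      refine (Finset.sum_le_sum hterm).trans (le_of_eq ?_)
      simp only [Finset.sum_const, Nat.card_Icc, nsmul_eq_mul, Nat.add_sub_cancel]
      field_simp
    have hgap' : (((Finset.range N).filter fun n => ‖f n‖ < η₀).card : ℝ) ≤
        ((N / (H + 1) : ℕ) : ℝ) + 1 + ∑ h ∈ Finset.Icc 1 H,
          (((Finset.range N).filter fun n => ‖f n‖ < η₀ ∧ ‖f (n + h)‖ < η₀).card : ℝ) := by
      exact_mod_cast hgap
    linarith

/-- The vector-valued version of `exists_card_norm_lt_le`. -/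
theorem exists_card_norm_lt_le_of_vector {ι V : Type*} [Fintype ι] [NormedAddCommGroup V]
    [NormedSpace ℂ V] {z : ι → ℂ} (hz : ∀ j, ‖z j‖ = 1)
    (hzz : ∀ j k, j ≠ k → ∀ h : ℕ, 1 ≤ h → z j ^ h ≠ z k ^ h) (c : ι → V)
    (hc : c ≠ 0) {δ : ℝ} (hδ : 0 < δ) :
    ∃ η > 0, ∀ᶠ N : ℕ in atTop,
      (((Finset.range N).filter fun n => ‖∑ j, z j ^ n • c j‖ < η).card : ℝ) ≤ δ * N := by
  classical
  obtain ⟨j₀, hj₀⟩ := Function.ne_iff.1 hc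
  -- A norm-one functional that is nonzero at `c j₀` reduces to scalars with the same threshold.
  obtain ⟨g, hg1, hg⟩ := exists_dual_vector ℂ (c j₀) (norm_ne_zero_iff.2 hj₀)
  have hgc : g (c j₀) ≠ 0 := by
    rw [hg]; simpa using hj₀
  set s := Finset.univ.filter fun j => g (c j) ≠ 0 with hs
  obtain ⟨η, hη, h⟩ := exists_card_norm_lt_le hz (s := s) ⟨j₀, by simpa [hs] using hgc⟩
    (fun j _ k _ => hzz j k) (fun j => g (c j)) (fun j hj => (Finset.mem_filter.1 hj).2) hδ
  refine ⟨η, hη, h.mono fun N hN => le_trans ?_ hN⟩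
  norm_cast
  refine Finset.card_le_card fun n hn => ?_
  simp only [Finset.mem_filter] at hn ⊢
  refine ⟨hn.1, ?_⟩
  have : ∑ j ∈ s, g (c j) * z j ^ n = g (∑ j, z j ^ n • c j) := by
    rw [map_sum, hs, Finset.sum_filter]
    refine Finset.sum_congr rfl fun j _ => ?_
    split_ifs with h0
    · simp [mul_comm]
    · simp only [not_not] at h0; simp [h0]
  rw [this]
  refine (g.le_opNorm _).trans_lt ?_
  rw [hg1, one_mul]; exact hn.2

/-! ### Twisted averages along torus orbits -/

/-- Summation by parts: `(ζ - 1) ∑ w n ζ ^ n` is a bounded boundary term minus `∑ (w (n + 1) - w n)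
ζ ^ (n + 1)`, whose averages are Cesàro means of a null sequence. -/
theorem tendsto_avg_mul_pow {w : ℕ → ℂ} {C : ℝ} (hw : ∀ n, ‖w n‖ ≤ C)
    (hd : Tendsto (fun n => w (n + 1) - w n) atTop (𝓝 0)) {ζ : ℂ} (hζ : ‖ζ‖ = 1) (hζ1 : ζ ≠ 1) :
    Tendsto (fun N : ℕ => (N : ℂ)⁻¹ * ∑ n ∈ Finset.range N, w n * ζ ^ n) atTop (𝓝 0) := by
  have hpow : ∀ n, ‖ζ ^ n‖ = 1 := fun n => by rw [norm_pow, hζ, one_pow]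
  have h1 : Tendsto (fun N : ℕ => (N : ℂ)⁻¹ * (w N * ζ ^ N - w 0)) atTop (𝓝 0) := by
    refine squeeze_zero_norm (a := fun N : ℕ => (N : ℝ)⁻¹ * (C + C)) (fun N => ?_) ?_
    · rw [norm_mul, norm_inv, Complex.norm_natCast]
      refine mul_le_mul_of_nonneg_left ((norm_sub_le _ _).trans (add_le_add ?_ (hw 0)))
        (by positivity)
      rw [norm_mul, hpow, mul_one]; exact hw N
    · simpa using (tendsto_inv_atTop_nhds_zero_nat (𝕜 := ℝ)).mul_const (C + C)
  have h2 : Tendsto (fun N : ℕ => (N : ℂ)⁻¹ *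
      ∑ n ∈ Finset.range N, (w (n + 1) - w n) * ζ ^ (n + 1)) atTop (𝓝 0) := by
    have : Tendsto (fun n => (w (n + 1) - w n) * ζ ^ (n + 1)) atTop (𝓝 0) := by
      rw [tendsto_zero_iff_norm_tendsto_zero] at hd ⊢
      refine hd.congr fun n => ?_
      rw [norm_mul, hpow, mul_one]
    refine this.cesaro_smul.congr fun N => ?_
    rw [Complex.real_smul]; push_cast; rfl
  have h3 := (h1.sub h2).const_mul (ζ - 1)⁻¹
  rw [sub_zero, mul_zero] at h3
  refine h3.congr fun N => ?_
  rw [inv_mul_eq_iff_eq_mul₀ (sub_ne_zero.2 hζ1), ← mul_sub, mul_left_comm]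
  congr 1
  have := Finset.sum_range_sub (fun n => w n * ζ ^ n) N
  simp only [pow_zero, mul_one] at this
  rw [← this, ← Finset.sum_sub_distrib, Finset.mul_sum]
  exact Finset.sum_congr rfl fun n _ => by ring

/-- `n` times the point of the torus with coordinates `θ`. -/
def torusOrbit {ι : Type*} (θ : ι → ℝ) (n : ℕ) : UnitAddTorus ι :=
  fun j => ((n * θ j : ℝ) : UnitAddCircle)

theorem fourier_coe_real (m : ℤ) (x : ℝ) :
    fourier m (x : UnitAddCircle) = Complex.exp (2 * Real.pi * Complex.I * (m * x : ℝ)) := by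
  rw [fourier_coe_apply]; congr 1; push_cast; ring

theorem mFourier_torusOrbit {ι : Type*} [Fintype ι] (θ : ι → ℝ) (m : ι → ℤ) (n : ℕ) :
    UnitAddTorus.mFourier m (torusOrbit θ n) =
      Complex.exp (2 * Real.pi * Complex.I * (∑ j, m j * θ j : ℝ)) ^ n := by
  rw [← Complex.exp_nat_mul]
  simp only [UnitAddTorus.mFourier, ContinuousMap.coe_mk, torusOrbit, fourier_coe_real,
    ← Complex.exp_sum]
  congr 1
  push_cast
  simp only [Finset.mul_sum]
  exact Finset.sum_congr rfl fun j _ => by ring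

theorem norm_exp_two_pi_mul_I (x : ℝ) : ‖Complex.exp (2 * Real.pi * Complex.I * x)‖ = 1 := by
  have : 2 * Real.pi * Complex.I * x = (2 * Real.pi * x : ℝ) * Complex.I := by push_cast; ring
  rw [this, Complex.norm_exp_ofReal_mul_I]

theorem exp_two_pi_mul_I_eq_one_iff (x : ℝ) :
    Complex.exp (2 * Real.pi * Complex.I * x) = 1 ↔ ∃ n : ℤ, x = n := by
  rw [Complex.exp_eq_one_iff]
  refine exists_congr fun n => ?_
  rw [mul_comm (n : ℂ), mul_right_inj' Complex.two_pi_I_ne_zero]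
  norm_cast

/-- Averages along an orbit on the torus, twisted by a slowly varying weight and a character
that is independent of the orbit, vanish. -/
theorem tendsto_avg_torusOrbit {ι : Type*} [Fintype ι] {w : ℕ → ℂ} (hw : ∀ n, ‖w n‖ ≤ 1)
    (hd : Tendsto (fun n => w (n + 1) - w n) atTop (𝓝 0)) (θ : ι → ℝ) (α : ℝ)
    (hα : ∀ (m : ι → ℤ) (l : ℤ), α + ∑ j, m j * θ j ≠ l) (Φ : C(UnitAddTorus ι, ℂ)) :
    Tendsto (fun N : ℕ => (N : ℂ)⁻¹ * ∑ n ∈ Finset.range N,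
      w n * Complex.exp (2 * Real.pi * Complex.I * α) ^ n * Φ (torusOrbit θ n)) atTop (𝓝 0) := by
  let L : ℕ → C(UnitAddTorus ι, ℂ) →ₗ[ℂ] ℂ := fun N =>
    { toFun := fun Φ => (N : ℂ)⁻¹ * ∑ n ∈ Finset.range N,
        w n * Complex.exp (2 * Real.pi * Complex.I * α) ^ n * Φ (torusOrbit θ n)
      map_add' := fun f g => by
        simp only [ContinuousMap.add_apply, mul_add, Finset.sum_add_distrib]
      map_smul' := fun c f => by
        simp only [ContinuousMap.smul_apply, smul_eq_mul, RingHom.id_apply, Finset.mul_sum]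
        exact Finset.sum_congr rfl fun n _ => by ring }
  refine tendsto_zero_of_dense_span L 1 (fun N f => ?_) _
    UnitAddTorus.span_mFourier_closure_eq_top ?_ Φ
  · rw [one_mul]
    refine norm_avg_le (fun n => ?_) N
    rw [norm_mul, norm_mul, norm_pow, norm_exp_two_pi_mul_I, one_pow, mul_one]
    calc _ ≤ 1 * ‖f‖ :=
          mul_le_mul (hw n) (f.norm_coe_le_norm _) (norm_nonneg _) zero_le_one
      _ = _ := one_mul _
  · rintro _ ⟨m, rfl⟩
    -- On the character `m` the orbit and the twist combine into powers of `e(α + ∑ m j θ j) ≠ 1`.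
    have key := tendsto_avg_mul_pow hw hd (ζ := Complex.exp (2 * Real.pi * Complex.I *
      (α + ∑ j, m j * θ j : ℝ))) (norm_exp_two_pi_mul_I _) (fun h => by
        obtain ⟨l, hl⟩ := (exp_two_pi_mul_I_eq_one_iff _).1 h
        exact hα m l hl)
    refine key.congr fun N => ?_
    simp only [L, LinearMap.coe_mk, AddHom.coe_mk, mFourier_torusOrbit]
    congr 1
    refine Finset.sum_congr rfl fun n _ => ?_
    rw [mul_assoc (w n), ← mul_pow, ← Complex.exp_add]
    congr 3
    push_cast; ring

/-! ### From asymptotics to the Benford property -/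

/-- Sequences that are close to each other outside a set of small density have almost the same
averages. -/
theorem tendsto_avg_zero_of_approx {g : ℕ → ℂ}
    (h : ∀ δ > 0, ∃ (g' : ℕ → ℂ) (κ : ℕ → ℝ) (E : Set ℕ), (∀ n, ‖g n - g' n‖ ≤ 2) ∧
      Tendsto κ atTop (𝓝 0) ∧ (∀ᶠ n in atTop, n ∉ E → ‖g n - g' n‖ ≤ κ n) ∧
      (∀ᶠ N : ℕ in atTop, (((Finset.range N : Set ℕ) ∩ E).ncard : ℝ) ≤ δ * N) ∧
      Tendsto (fun N : ℕ => (N : ℂ)⁻¹ * ∑ n ∈ Finset.range N, g' n) atTop (𝓝 0)) :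
    Tendsto (fun N : ℕ => (N : ℂ)⁻¹ * ∑ n ∈ Finset.range N, g n) atTop (𝓝 0) := by
  classical
  rw [Metric.tendsto_atTop']
  intro δ hδ
  obtain ⟨g', κ, E, h2, hκ, hE, hcard, hg'⟩ := h (δ / 8) (by positivity)
  -- The excess of the error over `2 · 1_E`: zero on `E`, and eventually at most `|κ n|` elsewhere.
  -- The part on `E` averages to at most `2 * (δ / 8) = δ / 4`.
  set κ' : ℕ → ℝ := fun n => max 0 (‖g n - g' n‖ - E.indicator (fun _ => 2) n) with hκ'
  have hκ'0 : Tendsto κ' atTop (𝓝 0) := by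
    refine tendsto_of_tendsto_of_tendsto_of_le_of_le' tendsto_const_nhds
      (by simpa using hκ.abs) (Eventually.of_forall fun n => le_max_left _ _) ?_
    filter_upwards [hE] with n hn
    refine max_le (abs_nonneg _) ?_
    by_cases hnE : n ∈ E
    · rw [Set.indicator_of_mem hnE]; linarith [h2 n, abs_nonneg (κ n)]
    · rw [Set.indicator_of_notMem hnE]; linarith [hn hnE, le_abs_self (κ n)]
  have hbd : ∀ n, ‖g n - g' n‖ ≤ κ' n + E.indicator (fun _ => 2) n := fun n => by
    linarith [le_max_right 0 (‖g n - g' n‖ - E.indicator (fun _ => (2 : ℝ)) n)]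
  have hev : ∀ᶠ N : ℕ in atTop, dist ((N : ℂ)⁻¹ * ∑ n ∈ Finset.range N, g n) 0 < δ := by
    filter_upwards [hcard, eventually_gt_atTop 0,
      (Metric.tendsto_nhds.1 hg') (δ / 4) (by positivity),
      (Metric.tendsto_nhds.1 hκ'0.cesaro) (δ / 4) (by positivity)] with N h1 h0 h3 h4
    have hN : (0 : ℝ) < N := by exact_mod_cast h0
    rw [dist_zero_right] at h3 h4 ⊢
    have hsum : ∑ n ∈ Finset.range N, E.indicator (fun _ => (2 : ℝ)) n =
        2 * (((Finset.range N : Set ℕ) ∩ E).ncard : ℝ) := by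
      have : (Finset.range N : Set ℕ) ∩ E = ((Finset.range N).filter (· ∈ E) : Finset ℕ) := by
        ext; simp
      rw [this, Set.ncard_coe_finset, Finset.card_filter]
      push_cast
      rw [Finset.mul_sum]
      exact Finset.sum_congr rfl fun n _ => by simp [Set.indicator_apply]
    have hdiff : ‖(N : ℂ)⁻¹ * ∑ n ∈ Finset.range N, (g n - g' n)‖ ≤
        (N : ℝ)⁻¹ * ∑ n ∈ Finset.range N, κ' n + δ / 4 := by
      rw [norm_mul, norm_inv, Complex.norm_natCast]
      calc _ ≤ (N : ℝ)⁻¹ * ∑ n ∈ Finset.range N, (κ' n + E.indicator (fun _ => 2) n) :=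
            mul_le_mul_of_nonneg_left
              ((norm_sum_le _ _).trans (Finset.sum_le_sum fun n _ => hbd n)) (by positivity)
        _ = (N : ℝ)⁻¹ * ∑ n ∈ Finset.range N, κ' n +
            (N : ℝ)⁻¹ * (2 * (((Finset.range N : Set ℕ) ∩ E).ncard : ℝ)) := by
              rw [Finset.sum_add_distrib, hsum, mul_add]
        _ ≤ _ := by
              refine add_le_add le_rfl ?_
              rw [inv_mul_le_iff₀ hN]; linarith
    have hsplit : (N : ℂ)⁻¹ * ∑ n ∈ Finset.range N, g n =
        (N : ℂ)⁻¹ * ∑ n ∈ Finset.range N, g' n +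
          (N : ℂ)⁻¹ * ∑ n ∈ Finset.range N, (g n - g' n) := by
      rw [Finset.sum_sub_distrib]; ring
    rw [hsplit]
    refine (norm_add_le _ _).trans_lt ?_
    linarith [le_abs_self ((N : ℝ)⁻¹ * ∑ n ∈ Finset.range N, κ' n),
      Real.norm_eq_abs ((N : ℝ)⁻¹ * ∑ n ∈ Finset.range N, κ' n)]
  obtain ⟨N₀, hN₀⟩ := eventually_atTop.1 hev
  exact ⟨N₀, fun N hN => hN₀ N hN.le⟩

theorem norm_exp_two_pi_mul_I_sub_le (x y : ℝ) :
    ‖Complex.exp (2 * Real.pi * Complex.I * x) - Complex.exp (2 * Real.pi * Complex.I * y)‖ ≤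
      2 * Real.pi * |x - y| := by
  have h1 : Complex.exp (2 * Real.pi * Complex.I * x) =
      Complex.exp (2 * Real.pi * Complex.I * y) *
        Complex.exp (Complex.I * (2 * Real.pi * (x - y) : ℝ)) := by
    rw [← Complex.exp_add]; congr 1; push_cast; ring
  rw [h1, ← mul_sub_one, norm_mul, norm_exp_two_pi_mul_I, one_mul]
  refine Real.norm_exp_I_mul_ofReal_sub_one_le.trans (le_of_eq ?_)
  rw [Real.norm_eq_abs, abs_mul, abs_of_pos Real.two_pi_pos]

theorem abs_log_sub_log_le {x y η : ℝ} (hη : 0 < η) (hx : η ≤ x) (hy : η ≤ y) :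
    |Real.log x - Real.log y| ≤ |x - y| / η := by
  have key : ∀ x y : ℝ, η ≤ x → η ≤ y → Real.log x - Real.log y ≤ |x - y| / η := by
    intro x y hx hy
    have hx0 := hη.trans_le hx
    have hy0 := hη.trans_le hy
    rw [← Real.log_div hx0.ne' hy0.ne']
    refine (Real.log_le_sub_one_of_pos (div_pos hx0 hy0)).trans ?_
    rw [div_sub_one hy0.ne']
    calc _ ≤ |x - y| / y := by gcongr; exact le_abs_self _
      _ ≤ _ := by gcongr
  refine abs_le.2 ⟨?_, key x y hx hy⟩
  have := key y x hy hx
  rw [abs_sub_comm] at this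
  linarith

theorem fourier_logb_mul {b : ℝ} (h : ℤ) {x y : ℝ} (hx : 0 < x) (hy : 0 < y) :
    fourier h (Real.logb b (x * y) : UnitAddCircle) =
      fourier h (Real.logb b x : UnitAddCircle) * fourier h (Real.logb b y : UnitAddCircle) := by
  rw [Real.logb_mul hx.ne' hy.ne', fourier_coe_real, fourier_coe_real, fourier_coe_real,
    ← Complex.exp_add]
  congr 1; push_cast; ring

theorem fourier_logb_pow {b : ℝ} (h : ℤ) (r : ℝ) (n : ℕ) :
    fourier h (Real.logb b (r ^ n) : UnitAddCircle) =
      Complex.exp (2 * Real.pi * Complex.I * (h * Real.logb b r : ℝ)) ^ n := by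
  rw [Real.logb_pow, fourier_coe_real, ← Complex.exp_nat_mul]
  congr 1; push_cast; ring

theorem norm_fourier_apply (h : ℤ) (x : UnitAddCircle) : ‖fourier h x‖ = 1 := by
  rw [fourier_apply]; exact Circle.norm_coe _

theorem norm_fourier_logb_sub_le {b : ℝ} (hb : 1 < b) (h : ℤ) {x y η : ℝ} (hη : 0 < η)
    (hx : η ≤ x) (hy : η ≤ y) :
    ‖fourier h (Real.logb b x : UnitAddCircle) - fourier h (Real.logb b y : UnitAddCircle)‖ ≤
      2 * Real.pi * |(h : ℝ)| / Real.log b / η * |x - y| := by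
  rw [fourier_coe_real, fourier_coe_real]
  refine (norm_exp_two_pi_mul_I_sub_le _ _).trans ?_
  have hlb := Real.log_pos hb
  rw [← mul_sub, abs_mul, Real.logb, Real.logb, ← sub_div, abs_div, abs_of_pos hlb]
  have := abs_log_sub_log_le hη hx hy
  calc _ ≤ 2 * Real.pi * (|(h : ℝ)| * (|x - y| / η / Real.log b)) := by gcongr
    _ = _ := by ring

/-- The two characters differ by the factor `e(h log_b (a (n + 1) / a n))`, which tends to 1. -/
theorem tendsto_fourier_logb_succ_sub {b : ℝ} {a : ℕ → ℝ} (ha : ∀ᶠ n in atTop, 0 < a n)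
    (ha1 : Tendsto (fun n => a (n + 1) / a n) atTop (𝓝 1)) (h : ℤ) :
    Tendsto (fun n => fourier h (Real.logb b (a (n + 1)) : UnitAddCircle) -
      fourier h (Real.logb b (a n) : UnitAddCircle)) atTop (𝓝 0) := by
  have h1 : Tendsto (fun n => fourier h (Real.logb b (a (n + 1) / a n) : UnitAddCircle) - 1)
      atTop (𝓝 0) := by
    have hl : Tendsto (fun n => Real.logb b (a (n + 1) / a n)) atTop (𝓝 0) := by
      have := ((Real.continuousAt_log one_ne_zero).tendsto.comp ha1).div_const (Real.log b)
      simpa [Real.logb] using this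
    have hc : Continuous fun x : ℝ => fourier h (x : UnitAddCircle) - 1 :=
      ((map_continuous _).comp (AddCircle.continuous_mk' 1)).sub continuous_const
    simpa [Function.comp_def] using (hc.tendsto 0).comp hl
  rw [tendsto_zero_iff_norm_tendsto_zero] at h1 ⊢
  refine h1.congr' ?_
  filter_upwards [ha, (tendsto_add_atTop_nat 1).eventually ha] with n hn hn1
  have : a (n + 1) = a (n + 1) / a n * a n := by field_simp
  conv_rhs => rw [this, fourier_logb_mul h (div_pos hn1 hn) hn, ← sub_one_mul, norm_mul,
    norm_fourier_apply, mul_one]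

/-- A vector-valued sequence that is asymptotic to `r ^ n * a n` times a non-zero exponential sum,
with `a` slowly varying and frequencies that are independent of each other and of `log_b r`, has
Benford norms. -/
theorem isBenford_norm_of_asymptotic {b : ℕ} (hb : 2 ≤ b) {ι V : Type*} [Fintype ι]
    [NormedAddCommGroup V] [NormedSpace ℂ V] {u : ℕ → V} {r : ℝ} (hr : 0 < r) {a : ℕ → ℝ}
    (ha : ∀ᶠ n in atTop, 0 < a n) (ha1 : Tendsto (fun n => a (n + 1) / a n) atTop (𝓝 1))
    {θ : ι → ℝ} {c : ι → V} (hc : c ≠ 0)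
    (hθ : ∀ j k, j ≠ k → ∀ (h : ℕ) (l : ℤ), 1 ≤ h → h * (θ j - θ k) ≠ l)
    (hα : ∀ (h : ℤ) (m : ι → ℤ) (l : ℤ), h ≠ 0 →
      h * Real.logb b r + ∑ j, m j * θ j ≠ l)
    (hu : Tendsto (fun n : ℕ => ((r ^ n * a n : ℝ) : ℂ)⁻¹ • u n -
      ∑ j, Complex.exp (2 * Real.pi * Complex.I * θ j) ^ n • c j) atTop (𝓝 0)) :
    IsBenford b fun n => ‖u n‖ := by
  have hb1 : (1 : ℝ) < b := by exact_mod_cast hb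
  refine isBenford_of_weyl hb fun h hh => tendsto_avg_zero_of_approx fun δ hδ => ?_
  set F : ℕ → V := fun n => ∑ j, Complex.exp (2 * Real.pi * Complex.I * θ j) ^ n • c j with hF
  set ε : ℕ → V := fun n => ((r ^ n * a n : ℝ) : ℂ)⁻¹ • u n - F n with hε
  obtain ⟨η, hη, hcard⟩ := exists_card_norm_lt_le_of_vector
    (z := fun j => Complex.exp (2 * Real.pi * Complex.I * θ j))
    (fun j => norm_exp_two_pi_mul_I (θ j)) (fun j k hjk m hm heq => by
      have h1 : Complex.exp (2 * Real.pi * Complex.I * (m * (θ j - θ k) : ℝ)) = 1 := by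
        have : 2 * Real.pi * Complex.I * (m * (θ j - θ k) : ℝ) =
          m * (2 * Real.pi * Complex.I * θ j) - m * (2 * Real.pi * Complex.I * θ k) := by
            push_cast; ring
        rw [this, Complex.exp_sub, Complex.exp_nat_mul, Complex.exp_nat_mul, heq,
          div_self (pow_ne_zero _ (Complex.exp_ne_zero _))]
      obtain ⟨l, hl⟩ := (exp_two_pi_mul_I_eq_one_iff _).1 h1
      exact hθ j k hjk m l hm hl) c hc hδ
  -- Truncating at `η / 2` makes the logarithm continuous on the whole torus. The truncation is
  -- inactive where `‖F n‖ ≥ η`, and there `‖F n + ε n‖` also eventually exceeds `η / 2`.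
  let Φ : C(UnitAddTorus ι, ℂ) :=
    { toFun := fun t =>
        fourier h (Real.logb b (max ‖∑ j, fourier 1 (t j) • c j‖ (η / 2)) : UnitAddCircle)
      continuous_toFun := by
        have h1 : Continuous fun t : UnitAddTorus ι =>
            max ‖∑ j, fourier 1 (t j) • c j‖ (η / 2) := by
          refine (continuous_norm.comp (continuous_finsetSum _ fun j _ => ?_)).max
            continuous_const
          exact ((map_continuous (fourier (T := (1 : ℝ)) 1)).comp (continuous_apply j)).smul
            continuous_const
        have h2 : Continuous fun t : UnitAddTorus ι =>
            Real.logb b (max ‖∑ j, fourier 1 (t j) • c j‖ (η / 2)) :=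
          (h1.log fun t => (lt_max_of_lt_right (half_pos hη)).ne').div_const _
        exact (map_continuous _).comp ((AddCircle.continuous_mk' 1).comp h2) }
  have hΦ : ∀ n, Φ (torusOrbit θ n) =
      fourier h (Real.logb b (max ‖F n‖ (η / 2)) : UnitAddCircle) := by
    intro n
    have : ∀ j, fourier 1 (torusOrbit θ n j) =
        Complex.exp (2 * Real.pi * Complex.I * θ j) ^ n := fun j => by
      rw [torusOrbit, fourier_coe_real, ← Complex.exp_nat_mul]
      congr 1; push_cast; ring
    simp only [Φ, ContinuousMap.coe_mk, this, hF]
  refine ⟨_, fun n => 2 * Real.pi * |(h : ℝ)| / Real.log b / (η / 2) * ‖ε n‖, {n | ‖F n‖ < η},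
    ?_, ?_, ?_, ?_, tendsto_avg_torusOrbit
      (w := fun n => fourier h (Real.logb b (a n) : UnitAddCircle))
      (fun n => (norm_fourier_apply _ _).le) (tendsto_fourier_logb_succ_sub ha ha1 h) θ
      (h * Real.logb b r) (fun m l => hα h m l hh) Φ⟩
  · intro n
    refine (norm_sub_le _ _).trans ?_
    rw [norm_mul, norm_mul, norm_pow, norm_exp_two_pi_mul_I, hΦ, norm_fourier_apply,
      norm_fourier_apply, norm_fourier_apply]
    norm_num
  · simpa using hu.norm.const_mul (2 * Real.pi * |(h : ℝ)| / Real.log b / (η / 2))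
  · have hε0 : ∀ᶠ n in atTop, ‖ε n‖ < η / 2 := by
      have := hu.norm
      rw [norm_zero] at this
      exact this.eventually_lt_const (half_pos hη)
    filter_upwards [ha, hε0] with n han hεn hn
    replace hn : η ≤ ‖F n‖ := not_lt.1 hn
    have hsum : ‖F n‖ - ‖ε n‖ ≤ ‖F n + ε n‖ := by
      have := norm_sub_norm_le (F n) (-ε n)
      simpa using this
    have hpos : 0 < r ^ n * a n := mul_pos (pow_pos hr n) han
    have hnorm : |‖u n‖| = r ^ n * (a n * ‖F n + ε n‖) := by
      have : u n = ((r ^ n * a n : ℝ) : ℂ) • (F n + ε n) := by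
        rw [hε, add_sub_cancel, smul_inv_smul₀]
        exact_mod_cast hpos.ne'
      rw [abs_norm, this, norm_smul, Complex.norm_real, Real.norm_of_nonneg hpos.le]
      ring
    have hFε : 0 < ‖F n + ε n‖ := by linarith
    rw [hnorm, fourier_logb_mul h (pow_pos hr n) (mul_pos han hFε), fourier_logb_mul h han hFε,
      fourier_logb_pow, hΦ, max_eq_left (by linarith), mul_left_comm, ← mul_assoc, ← mul_sub,
      norm_mul, norm_mul, norm_pow, norm_exp_two_pi_mul_I, norm_fourier_apply, one_pow, one_mul,
      one_mul]
    refine (norm_fourier_logb_sub_le hb1 h (half_pos hη) (by linarith) (by linarith)).trans ?_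
    refine mul_le_mul_of_nonneg_left ?_ ?_
    · refine (abs_norm_sub_norm_le _ _).trans ?_
      rw [add_sub_cancel_left]
    · have := Real.log_pos hb1; positivity
  · refine hcard.mono fun N hN => le_trans (le_of_eq ?_) hN
    congr 1
    rw [← Set.ncard_coe_finset]
    congr 1
    ext; simp [hF]

/-! ### Powers in a finite-dimensional algebra -/

/-- The set of sequences `n ↦ (n.choose i * z ^ n) • w` with `z ∈ Z`. -/
def chooseMulPow (V : Type*) [AddCommGroup V] [Module ℂ V] (Z : Set ℂ) : Set (ℕ → V) :=
  {s | ∃ z ∈ Z, ∃ (i : ℕ) (w : V), s = fun n => ((n.choose i : ℂ) * z ^ n) • w}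

/-- Terms are collected by the pair `(z, i)`, so that a dominant pair with nonzero coefficient can
be selected. -/
theorem exists_finsupp_of_mem_closure {V : Type*} [AddCommGroup V] [Module ℂ V] {Z : Set ℂ}
    {s : ℕ → V} (hs : s ∈ AddSubmonoid.closure (chooseMulPow V Z)) :
    ∃ c : ℂ × ℕ →₀ V, (∀ p ∈ c.support, p.1 ∈ Z) ∧
      ∀ n, s n = c.sum fun p w => ((n.choose p.2 : ℂ) * p.1 ^ n) • w := by
  classical
  induction hs using AddSubmonoid.closure_induction with
  | mem s hs =>
    obtain ⟨z, hz, i, w, rfl⟩ := hs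
    refine ⟨Finsupp.single (z, i) w, fun p hp => ?_, fun n => by simp⟩
    rw [Finset.mem_singleton.1 (Finsupp.support_single_subset hp)]
    exact hz
  | zero => exact ⟨0, by simp, by simp⟩
  | add s t _ _ hs ht =>
    obtain ⟨c, hc, hcs⟩ := hs
    obtain ⟨e, he, het⟩ := ht
    refine ⟨c + e, fun p hp => ?_, fun n => ?_⟩
    · rcases Finset.mem_union.1 (Finsupp.support_add hp) with h | h
      exacts [hc p h, he p h]
    · rw [Finsupp.sum_add_index' (by simp) (by simp), Pi.add_apply, hcs, het]

/-- The powers of a unit of a finite-dimensional algebra are combinations of sequences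
`n ↦ n.choose i * z ^ n` with `z` in the spectrum. -/
theorem exists_pow_eq_sum {R : Type*} [Ring R] [Algebra ℂ R] [FiniteDimensional ℂ R] {x : R}
    (hx : IsUnit x) :
    ∃ c : ℂ × ℕ →₀ R, (∀ p ∈ c.support, p.1 ∈ spectrum ℂ x) ∧
      ∀ n, x ^ n = c.sum fun p w => ((n.choose p.2 : ℂ) * p.1 ^ n) • w := by
  suffices h : ∀ v : R, (fun n => x ^ n * v) ∈
      AddSubmonoid.closure (chooseMulPow R (spectrum ℂ x)) by
    simpa using exists_finsupp_of_mem_closure (h 1)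
  intro v
  -- Decompose `v` under left multiplication by `x`. Where `(x - μ) ^ k * v = 0`, the binomial
  -- theorem for `x = y + μ` leaves only the terms with `i < k`.
  have hv : v ∈ ⨆ μ : ℂ, Module.End.maxGenEigenspace (LinearMap.mulLeft ℂ x) μ := by
    rw [Module.End.iSup_maxGenEigenspace_eq_top]; trivial
  refine Submodule.iSup_induction _ (motive := fun v => (fun n => x ^ n * v) ∈
      AddSubmonoid.closure (chooseMulPow R (spectrum ℂ x))) hv (fun μ v hv => ?_) ?_ ?_
  · obtain ⟨k, hk⟩ := Module.End.mem_maxGenEigenspace _ _ _ |>.1 hv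
    set y : R := x - algebraMap ℂ R μ with hy
    have hT : LinearMap.mulLeft ℂ x - μ • (1 : Module.End ℂ R) = LinearMap.mulLeft ℂ y := by
      ext w; simp [hy, sub_mul, Algebra.smul_def]
    rw [hT, LinearMap.pow_mulLeft, LinearMap.mulLeft_apply] at hk
    by_cases hμ : μ ∈ spectrum ℂ x
    · have hμ0 : μ ≠ 0 := by
        rintro rfl
        exact (spectrum.zero_notMem_iff ℂ).2 hx hμ
      -- The factor `(μ ^ i)⁻¹` turns `μ ^ (n - i)` into `μ ^ n`; this is where `x` being a unit
      -- matters.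
      have hsum : (fun n => x ^ n * v) = ∑ i ∈ Finset.range k,
          fun n => ((n.choose i : ℂ) * μ ^ n) • ((μ ^ i)⁻¹ • (y ^ i * v)) := by
        ext n
        have hterm : ∀ i, ((n.choose i : ℂ) * μ ^ n) • ((μ ^ i)⁻¹ • (y ^ i * v)) =
            y ^ i * algebraMap ℂ R μ ^ (n - i) * (n.choose i : R) * v := by
          intro i
          rcases le_or_gt i n with hi | hi
          · rw [smul_smul, mul_assoc, ← pow_sub₀ μ hμ0 hi, ← map_pow,
              ← Algebra.commutes, mul_assoc, mul_assoc, ← Algebra.smul_def, mul_comm, mul_smul]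
            congr 1
            rw [Nat.cast_smul_eq_nsmul ℂ, nsmul_eq_mul, ← mul_assoc, ← mul_assoc,
              (Nat.cast_commute _ _).eq]
          · simp [Nat.choose_eq_zero_of_lt hi]
        have hxy : x = y + algebraMap ℂ R μ := by simp [hy]
        rw [Finset.sum_apply]
        simp only [hterm]
        conv_lhs => rw [hxy, (Algebra.commute_algebraMap_right μ y).add_pow, Finset.sum_mul]
        have h0 : ∀ i, k ≤ i ∨ n + 1 ≤ i →
            y ^ i * algebraMap ℂ R μ ^ (n - i) * (n.choose i : R) * v = 0 := by
          rintro i (hi | hi)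
          · rw [← hterm, ← Nat.sub_add_cancel hi, pow_add y, mul_assoc (y ^ (i - k)), hk]
            simp
          · simp [Nat.choose_eq_zero_of_lt hi]
        -- Both sums are extended by zero terms to the range up to `max (n + 1) k`.
        exact (Finset.sum_subset (Finset.range_mono (le_max_left (n + 1) k)) fun i _ hi =>
          h0 i (Or.inr (by simpa using hi))).trans
          (Finset.sum_subset (Finset.range_mono (le_max_right (n + 1) k)) fun i _ hi =>
            h0 i (Or.inl (by simpa using hi))).symm
      rw [hsum]
      exact sum_mem fun i _ => AddSubmonoid.subset_closure ⟨μ, hμ, i, _, rfl⟩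
    · have hu : IsUnit y := by
        have := spectrum.notMem_iff.1 hμ
        rw [hy, ← neg_sub]; exact this.neg
      have hv0 : v = 0 := (hu.pow k).mul_right_eq_zero.1 hk
      subst hv0
      simp only [mul_zero]; exact zero_mem _
  · simp only [mul_zero]; exact zero_mem _
  · intro v w hv hw
    simp only [mul_add]
    exact add_mem hv hw

/-! ### Growth of binomial coefficients -/

theorem tendsto_choose_succ_div (k : ℕ) :
    Tendsto (fun n : ℕ => ((n + 1).choose k : ℝ) / n.choose k) atTop (𝓝 1) := by
  have h1 : Tendsto (fun n : ℕ => ((1 : ℝ) - k / ((n + 1 : ℕ) : ℝ))⁻¹) atTop (𝓝 1) := by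
    have := ((tendsto_const_div_atTop_nhds_zero_nat (k : ℝ)).comp
      (tendsto_add_atTop_nat 1)).const_sub 1 |>.inv₀ (by simp)
    simpa [Function.comp_def] using this
  refine h1.congr' ?_
  filter_upwards [eventually_ge_atTop k] with n hn
  have h2 := Nat.choose_mul_succ_eq n k
  have h3 : ((n.choose k : ℝ)) * (n + 1) = (n + 1).choose k * (n + 1 - k) := by
    have := congrArg (Nat.cast (R := ℝ)) h2
    rw [Nat.cast_mul, Nat.cast_mul, Nat.cast_sub (by lia)] at this
    exact_mod_cast this
  have h4 : (0 : ℝ) < n.choose k := by exact_mod_cast Nat.choose_pos hn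
  have h5 : (0 : ℝ) < n + 1 - k := by
    have : (k : ℝ) ≤ n := by exact_mod_cast hn
    linarith
  push_cast
  have h6 : (0 : ℝ) < n + 1 := by positivity
  rw [one_sub_div h6.ne', inv_div, div_eq_div_iff h5.ne' h4.ne']
  linarith

theorem tendsto_choose_div_choose {i k : ℕ} (hik : i < k) :
    Tendsto (fun n : ℕ => (n.choose i : ℝ) / n.choose k) atTop (𝓝 0) := by
  have step : ∀ k : ℕ, Tendsto (fun n : ℕ => (n.choose k : ℝ) / n.choose (k + 1)) atTop (𝓝 0) := by
    intro k
    have h1 := (tendsto_const_div_atTop_nhds_zero_nat ((k : ℝ) + 1)).comp (tendsto_sub_atTop_nat k)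
    refine h1.congr' ?_
    filter_upwards [eventually_gt_atTop k] with n hn
    have h2 := congrArg (Nat.cast (R := ℝ)) (Nat.choose_succ_right_eq n k)
    have h4 : (0 : ℝ) < n.choose (k + 1) := by exact_mod_cast Nat.choose_pos hn
    have h5 : (0 : ℝ) < (n - k : ℕ) := by exact_mod_cast Nat.sub_pos_of_lt hn
    simp only [Function.comp_apply]
    rw [div_eq_div_iff h5.ne' h4.ne']
    push_cast at h2
    linarith
  induction k, hik using Nat.le_induction with
  | base => exact step i
  | succ k hk ih =>
    have := ih.mul (step k)
    rw [zero_mul] at this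
    refine this.congr' ?_
    filter_upwards [eventually_ge_atTop k] with n hn
    have h4 : (0 : ℝ) < n.choose k := by exact_mod_cast Nat.choose_pos hn
    field_simp

theorem tendsto_choose_div_choose_mul_pow (i k : ℕ) {q : ℝ} (hq0 : 0 ≤ q) (hq1 : q < 1) :
    Tendsto (fun n : ℕ => (n.choose i : ℝ) / n.choose k * q ^ n) atTop (𝓝 0) := by
  refine squeeze_zero' (Eventually.of_forall fun n => by positivity) ?_
    (tendsto_pow_const_mul_const_pow_of_abs_lt_one i (by rwa [abs_of_nonneg hq0]))
  filter_upwards [eventually_ge_atTop k] with n hn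
  refine mul_le_mul_of_nonneg_right ?_ (by positivity)
  have h4 : (1 : ℝ) ≤ n.choose k := by exact_mod_cast Nat.choose_pos hn
  refine (div_le_self (by positivity) h4).trans ?_
  exact_mod_cast Nat.choose_le_pow n i

/-! ### Arithmetic consequences of nonresonance -/

theorem exp_arg_div_two_pi {z : ℂ} {r : ℝ} (hr : 0 < r) (hz : ‖z‖ = r) :
    Complex.exp (2 * Real.pi * Complex.I * (Complex.arg z / (2 * Real.pi) : ℝ)) = z / r := by
  rw [eq_div_iff (by exact_mod_cast hr.ne'), mul_comm]
  conv_rhs => rw [← Complex.norm_mul_exp_arg_mul_I z, hz]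
  congr 2
  push_cast
  have : (Real.pi : ℂ) ≠ 0 := by exact_mod_cast Real.pi_ne_zero
  field_simp

/-- The hypothesis makes an argument difference rational, hence equal to 1, so both arguments and
moduli agree. -/
theorem IsNonresonantOnCircle.arg_eq_of_mul_eq {b : ℕ} {r : ℝ} {Z : Set ℂ}
    (h : IsNonresonantOnCircle b r Z) {z w : ℂ} (hz : z ∈ Z) (hw : w ∈ Z) {n : ℕ} (hn : 1 ≤ n)
    {l : ℤ} (hl : n * (Complex.arg z / (2 * Real.pi) - Complex.arg w / (2 * Real.pi)) = l) :
    z = w := by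
  have hn0 : (n : ℝ) ≠ 0 := by exact_mod_cast (by lia : n ≠ 0)
  have hmem : 1 + (Complex.arg z - Complex.arg w) / (2 * Real.pi) ∈
      argDifferences Z ∩ Set.range (fun q : ℚ => (q : ℝ)) := by
    refine ⟨⟨z, hz, w, hw, rfl⟩, 1 + l / n, ?_⟩
    push_cast
    rw [← hl, sub_div]
    field_simp
  rw [h.2.2.1, Set.mem_singleton_iff] at hmem
  have harg : Complex.arg z = Complex.arg w := by
    have := Real.two_pi_pos
    have h0 : (Complex.arg z - Complex.arg w) / (2 * Real.pi) = 0 := by linarith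
    rcases div_eq_zero_iff.1 h0 with h1 | h1 <;> linarith
  exact Complex.ext_norm_arg ((h.2.1 z hz).trans (h.2.1 w hw).symm) harg

/-- Conjugation negates the argument, so the difference of the two is `2 arg z`. The exception `arg
z = π` gives `1 / 2`, a rational multiple of the element 1. -/
theorem arg_div_two_pi_mem_span {Z : Set ℂ} {z : ℂ} (hz : z ∈ Z)
    (hz' : (starRingEnd ℂ) z ∈ Z) :
    Complex.arg z / (2 * Real.pi) ∈ Submodule.span ℚ (argDifferences Z) := by
  have h1 : (1 : ℝ) ∈ Submodule.span ℚ (argDifferences Z) :=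
    Submodule.subset_span ⟨z, hz, z, hz, by simp⟩
  have hpi := Real.pi_pos
  by_cases hπ : Complex.arg z = Real.pi
  · have := Submodule.smul_mem _ (1 / 2 : ℚ) h1
    convert this using 1
    rw [hπ, Rat.smul_def]
    push_cast
    field_simp
  · have h2 : 1 + (Complex.arg z - Complex.arg ((starRingEnd ℂ) z)) / (2 * Real.pi) ∈
        Submodule.span ℚ (argDifferences Z) := Submodule.subset_span ⟨z, hz, _, hz', rfl⟩
    have := Submodule.smul_mem _ (1 / 2 : ℚ) (Submodule.sub_mem _ h2 h1)
    convert this using 1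
    rw [Complex.arg_conj, if_neg hπ, Rat.smul_def]
    push_cast
    ring

/-- Equality could be solved for `log_b r`, placing it in the excluded span. -/
theorem IsNonresonantOnCircle.mul_logb_add_sum_ne {b : ℕ} {r : ℝ} {Z : Set ℂ}
    (h : IsNonresonantOnCircle b r Z) (hconj : ∀ z ∈ Z, (starRingEnd ℂ) z ∈ Z) {ι : Type*}
    [Fintype ι] {z : ι → ℂ} (hz : ∀ j, z j ∈ Z) {n : ℤ} (hn : n ≠ 0) (m : ι → ℤ) (l : ℤ) :
    n * Real.logb b r + ∑ j, m j * (Complex.arg (z j) / (2 * Real.pi)) ≠ l := by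
  intro heq
  apply h.2.2.2
  obtain ⟨z₀, hz₀⟩ := h.1
  have h1 : (1 : ℝ) ∈ Submodule.span ℚ (argDifferences Z) :=
    Submodule.subset_span ⟨z₀, hz₀, z₀, hz₀, by simp⟩
  have hmem := Submodule.smul_mem _ (1 / n : ℚ) (Submodule.sub_mem _
    (Submodule.smul_mem _ (l : ℚ) h1) (Submodule.sum_mem (t := Finset.univ) _ fun j _ =>
      Submodule.smul_mem _ (m j : ℚ) (arg_div_two_pi_mem_span (hz j) (hconj _ (hz j)))))
  convert hmem using 1
  have hn' : (n : ℝ) ≠ 0 := by exact_mod_cast hn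
  simp only [Rat.smul_def]
  push_cast
  field_simp
  field_simp at heq
  linarith

/-! ### Dominant terms -/

/-- A non-trivial combination of the sequences `n ↦ n.choose i * z ^ n`, with `z` in a
nonresonant set closed under conjugation, has Benford norms. -/
theorem isBenford_norm_sum_choose {b : ℕ} (hb : 2 ≤ b) {V : Type*} [NormedAddCommGroup V]
    [NormedSpace ℂ V] {Z : Set ℂ} (hres : IsNonresonant b Z) (hZ0 : (0 : ℂ) ∉ Z)
    (hconj : ∀ z ∈ Z, (starRingEnd ℂ) z ∈ Z) {c : ℂ × ℕ →₀ V} (hc : c ≠ 0)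
    (hcZ : ∀ p ∈ c.support, p.1 ∈ Z) :
    IsBenford b fun n => ‖c.sum fun p w => ((n.choose p.2 : ℂ) * p.1 ^ n) • w‖ := by
  classical
  -- Growth is ordered lexicographically: modulus first, then binomial degree.
  obtain ⟨p₀, hp₀, hmax⟩ := Finset.exists_max_image c.support
    (fun p => toLex (‖p.1‖, p.2)) (Finsupp.support_nonempty_iff.2 hc)
  set r := ‖p₀.1‖ with hrdef
  set k := p₀.2 with hkdef
  have hr : 0 < r := norm_pos_iff.2 fun h => hZ0 (h ▸ hcZ p₀ hp₀)
  set S := c.support.filter fun p => ‖p.1‖ = r ∧ p.2 = k with hS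
  have hSmem : ∀ p : S, p.1.1 ∈ Z ∩ {z : ℂ | ‖z‖ = r} := fun p =>
    ⟨hcZ _ (Finset.mem_filter.1 p.2).1, (Finset.mem_filter.1 p.2).2.1⟩
  have hcircle : IsNonresonantOnCircle b r (Z ∩ {z : ℂ | ‖z‖ = r}) := by
    refine (hres r hr).resolve_right fun h => ?_
    have : p₀.1 ∈ Z ∩ {z : ℂ | ‖z‖ = r} := ⟨hcZ p₀ hp₀, rfl⟩
    rw [h] at this; exact this
  have hcircle_conj : ∀ z ∈ Z ∩ {z : ℂ | ‖z‖ = r},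
      (starRingEnd ℂ) z ∈ Z ∩ {z : ℂ | ‖z‖ = r} := fun z hz =>
    ⟨hconj z hz.1, (Complex.norm_conj z).trans hz.2⟩
  have hpos : ∀ᶠ n : ℕ in atTop, (0 : ℝ) < n.choose k :=
    (eventually_ge_atTop k).mono fun n hn => by exact_mod_cast Nat.choose_pos hn
  refine isBenford_norm_of_asymptotic hb hr (a := fun n => (n.choose k : ℝ)) hpos
    (tendsto_choose_succ_div k) (ι := S) (θ := fun p => Complex.arg p.1.1 / (2 * Real.pi))
    (c := fun p => c p.1) ?_ ?_ ?_ ?_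
  · intro h
    exact Finsupp.mem_support_iff.1 hp₀
      (congrFun h ⟨p₀, Finset.mem_filter.2 ⟨hp₀, rfl, rfl⟩⟩)
  · intro p q hpq h l hh hl
    refine hpq (Subtype.ext (Prod.ext (hcircle.arg_eq_of_mul_eq (hSmem p) (hSmem q) hh hl) ?_))
    exact (Finset.mem_filter.1 p.2).2.2.trans (Finset.mem_filter.1 q.2).2.2.symm
  · exact fun h m l hh => hcircle.mul_logb_add_sum_ne hcircle_conj hSmem hh m l
  · have hF : ∀ n : ℕ, ∑ j : S, Complex.exp (2 * Real.pi * Complex.I *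
        (Complex.arg j.1.1 / (2 * Real.pi) : ℝ)) ^ n • c j.1 =
        ∑ p ∈ c.support, (if ‖p.1‖ = r ∧ p.2 = k then (p.1 / r) ^ n else 0) • c p := by
      intro n
      rw [Finset.sum_congr rfl fun (j : S) _ => by
        rw [exp_arg_div_two_pi hr (Finset.mem_filter.1 j.2).2.1]]
      rw [Finset.sum_coe_sort S fun p => (p.1 / (r : ℂ)) ^ n • c p, hS, Finset.sum_filter]
      exact Finset.sum_congr rfl fun p _ => by split_ifs <;> simp
    simp only [hF, Finsupp.sum, Finset.smul_sum, ← Finset.sum_sub_distrib, smul_smul, ← sub_smul]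
    rw [← Finset.sum_const_zero (M := V) (s := c.support)]
    refine tendsto_finsetSum _ fun p hp => ?_
    rw [← zero_smul ℂ (c p)]
    refine Tendsto.smul_const ?_ (c p)
    have hnorm : ∀ n : ℕ, ‖((r ^ n * n.choose k : ℝ) : ℂ)⁻¹ * ((n.choose p.2 : ℂ) * p.1 ^ n)‖ =
        (n.choose p.2 : ℝ) / n.choose k * (‖p.1‖ / r) ^ n := by
      intro n
      rw [norm_mul, norm_inv, norm_mul, norm_pow, Complex.norm_real, Complex.norm_natCast,
        Real.norm_of_nonneg (by positivity), div_pow]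
      ring
    have hle := hmax p hp
    rw [Prod.Lex.toLex_le_toLex] at hle
    rcases hle with hlt | ⟨heq, hle⟩
    · simp only [hlt.ne, false_and, if_false, sub_zero]
      rw [tendsto_zero_iff_norm_tendsto_zero]
      simp only [hnorm]
      exact tendsto_choose_div_choose_mul_pow _ _ (by positivity) ((div_lt_one hr).2 hlt)
    · change ‖p.1‖ = r at heq
      rcases hle.lt_or_eq with hlt | hk
      · change p.2 < k at hlt
        simp only [hlt.ne, and_false, if_false, sub_zero]
        rw [tendsto_zero_iff_norm_tendsto_zero]
        simp only [hnorm, heq, div_self hr.ne', one_pow, mul_one]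
        exact tendsto_choose_div_choose hlt
      · change p.2 = k at hk
        simp only [heq, hk, and_self, if_true]
        refine tendsto_const_nhds.congr' ?_
        filter_upwards [hpos] with n hn
        have hn' : (n.choose k : ℂ) ≠ 0 := by exact_mod_cast hn.ne'
        have hr' : (r : ℂ) ≠ 0 := by exact_mod_cast hr.ne'
        push_cast
        rw [div_pow]
        field_simp
        simp

/-! ### Real matrices -/

open Matrix

theorem isBenford_norm_iff {b : ℕ} {x : ℕ → ℝ} :
    IsBenford b (fun n => ‖x n‖) ↔ IsBenford b x := by
  have h : ∀ n, significand b ‖x n‖ = significand b (x n) := fun n => by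
    simp only [significand, Real.norm_eq_abs, abs_abs, abs_eq_zero]
  simp only [IsBenford, h]

theorem conj_mem_complexSpectrum {d : ℕ} (A : Matrix (Fin d) (Fin d) ℝ) {z : ℂ}
    (hz : z ∈ complexSpectrum A) : (starRingEnd ℂ) z ∈ complexSpectrum A := by
  simp only [complexSpectrum, Matrix.mem_spectrum_iff_isRoot_charpoly, Matrix.charpoly_map,
    Polynomial.IsRoot, Polynomial.eval_map_algebraMap] at hz ⊢
  rw [Polynomial.aeval_conj, hz, map_zero]

/-- The image of the powers of a real matrix with nonresonant spectrum under a linear map has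
Benford norms unless it vanishes. -/
theorem isBenford_norm_map_pow {d b : ℕ} (hb : 2 ≤ b) {A : Matrix (Fin d) (Fin d) ℝ}
    (hA : IsUnit A) (hres : IsNonresonant b (complexSpectrum A)) {V : Type*}
    [NormedAddCommGroup V] [NormedSpace ℂ V] (L : Matrix (Fin d) (Fin d) ℂ →ₗ[ℂ] V) :
    IsBenford b (fun n => ‖L ((A ^ n).map (algebraMap ℝ ℂ))‖) ∨
      ∀ n, L ((A ^ n).map (algebraMap ℝ ℂ)) = 0 := by
  have hunit : IsUnit (A.map (algebraMap ℝ ℂ)) := hA.map (algebraMap ℝ ℂ).mapMatrix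
  obtain ⟨c, hc, hpow⟩ := exists_pow_eq_sum hunit
  have hL : ∀ n, L ((A ^ n).map (algebraMap ℝ ℂ)) =
      (c.mapRange L (map_zero L)).sum fun p w => ((n.choose p.2 : ℂ) * p.1 ^ n) • w := by
    intro n
    have : (A ^ n).map (algebraMap ℝ ℂ) = A.map (algebraMap ℝ ℂ) ^ n :=
      map_pow (algebraMap ℝ ℂ).mapMatrix A n
    rw [this, hpow, Finsupp.sum_mapRange_index (by simp), Finsupp.sum, Finsupp.sum, map_sum]
    simp
  simp only [hL]
  -- Either `L` kills every coefficient or a nontrivial combination remains.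
  by_cases h0 : c.mapRange L (map_zero L) = 0
  · exact Or.inr fun n => by rw [h0, Finsupp.sum_zero_index]
  · exact Or.inl (isBenford_norm_sum_choose hb hres ((spectrum.zero_notMem_iff ℂ).2 hunit)
      (fun z hz => conj_mem_complexSpectrum A hz) h0
      fun p hp => hc p (Finsupp.support_mapRange hp))

/-- A real matrix acts separately on real and imaginary parts, whose squared norms add, so
complexification preserves its norm. -/
theorem norm_toEuclideanCLM_map_ofReal {d : ℕ} (M : Matrix (Fin d) (Fin d) ℝ) :
    ‖Matrix.toEuclideanCLM (n := Fin d) (𝕜 := ℂ) (M.map (algebraMap ℝ ℂ))‖ =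
      ‖Matrix.toEuclideanCLM (n := Fin d) (𝕜 := ℝ) M‖ := by
  apply le_antisymm
  · refine ContinuousLinearMap.opNorm_le_bound _ (norm_nonneg _) fun x => ?_
    set C := ‖Matrix.toEuclideanCLM (n := Fin d) (𝕜 := ℝ) M‖
    have key : ∀ y : Fin d → ℝ, ∑ i, (M *ᵥ y) i ^ 2 ≤ C ^ 2 * ∑ i, y i ^ 2 := by
      intro y
      have h := (Matrix.toEuclideanCLM (n := Fin d) (𝕜 := ℝ) M).le_opNorm (WithLp.toLp 2 y)
      have h2 := pow_le_pow_left₀ (norm_nonneg _) h 2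
      rw [mul_pow, EuclideanSpace.real_norm_sq_eq, EuclideanSpace.real_norm_sq_eq] at h2
      exact h2
    have hre := key fun i => (x i).re
    have him := key fun i => (x i).im
    have hnorm : ∀ v : EuclideanSpace ℂ (Fin d),
        ‖v‖ ^ 2 = ∑ i, (v i).re ^ 2 + ∑ i, (v i).im ^ 2 := by
      intro v
      rw [EuclideanSpace.norm_sq_eq, ← Finset.sum_add_distrib]
      refine Finset.sum_congr rfl fun i _ => ?_
      rw [Complex.sq_norm, Complex.normSq_apply]; ring
    refine le_of_sq_le_sq ?_ (by positivity)
    have e1 : ∀ i, (Matrix.toEuclideanCLM (n := Fin d) (𝕜 := ℂ) (M.map (algebraMap ℝ ℂ)) x i).re =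
        (M *ᵥ fun i => (x i).re) i := by
      intro i
      change ((M.map (algebraMap ℝ ℂ) *ᵥ x.ofLp) i).re = _
      simp [Matrix.mulVec, dotProduct]
    have e2 : ∀ i, (Matrix.toEuclideanCLM (n := Fin d) (𝕜 := ℂ) (M.map (algebraMap ℝ ℂ)) x i).im =
        (M *ᵥ fun i => (x i).im) i := by
      intro i
      change ((M.map (algebraMap ℝ ℂ) *ᵥ x.ofLp) i).im = _
      simp [Matrix.mulVec, dotProduct]
    rw [mul_pow, hnorm, hnorm x]
    simp only [e1, e2]
    linarith
  · refine ContinuousLinearMap.opNorm_le_bound _ (norm_nonneg _) fun x => ?_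
    have h := (Matrix.toEuclideanCLM (n := Fin d) (𝕜 := ℂ) (M.map (algebraMap ℝ ℂ))).le_opNorm
      (WithLp.toLp 2 fun i => (x i : ℂ))
    have hnorm : ∀ y : EuclideanSpace ℝ (Fin d),
        ‖(WithLp.toLp 2 fun i => (y i : ℂ) : EuclideanSpace ℂ (Fin d))‖ = ‖y‖ := by
      intro y
      simp [EuclideanSpace.norm_eq]
    rw [hnorm x] at h
    rw [← hnorm]
    refine le_of_eq_of_le (congrArg norm ?_) h
    ext i
    change _ = (M.map (algebraMap ℝ ℂ) *ᵥ fun i => (x i : ℂ)) i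
    change (((M *ᵥ x.ofLp) i : ℝ) : ℂ) = _
    simp [Matrix.mulVec, dotProduct]

end BenfordLinear

end

theorem corollary3p11 (d : ℕ) (hd : 0 < d) (b : ℕ) (hb : 2 ≤ b)
    (A : Matrix (Fin d) (Fin d) ℝ) (hA : IsUnit A)
    (hres : BenfordLinear.IsNonresonant b (BenfordLinear.complexSpectrum A)) :
    (∀ x y : Fin d → ℝ,
      BenfordLinear.IsBenford b (fun n : ℕ => x ⬝ᵥ ((A ^ n).mulVec y)) ∨
        ∀ n : ℕ, x ⬝ᵥ ((A ^ n).mulVec y) = 0) ∧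
    (∀ x : Fin d → ℝ, x ≠ 0 →
      BenfordLinear.IsBenford b
        (fun n : ℕ => BenfordLinear.euclideanNorm ((A ^ n).mulVec x))) ∧
    BenfordLinear.IsBenford b (fun n : ℕ => BenfordLinear.matrixNorm (A ^ n)) := by
  have hvec : ∀ (M : Matrix (Fin d) (Fin d) ℝ) (y : Fin d → ℝ) (i : Fin d),
      (M.map (algebraMap ℝ ℂ)).mulVec (fun i => (y i : ℂ)) i = (M.mulVec y i : ℝ) := by
    intro M y i
    simp [Matrix.mulVec, dotProduct]
  refine ⟨fun x y => ?_, fun x hx => ?_, ?_⟩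
  · let L : Matrix (Fin d) (Fin d) ℂ →ₗ[ℂ] ℂ :=
      { toFun := fun M => (fun i => (x i : ℂ)) ⬝ᵥ M.mulVec (fun i => (y i : ℂ))
        map_add' := fun M N => by rw [Matrix.add_mulVec, dotProduct_add]
        map_smul' := fun c M => by rw [Matrix.smul_mulVec, dotProduct_smul]; rfl }
    have hL : ∀ n, L ((A ^ n).map (algebraMap ℝ ℂ)) = (x ⬝ᵥ ((A ^ n).mulVec y) : ℝ) := by
      intro n
      simp only [L, LinearMap.coe_mk, AddHom.coe_mk, dotProduct, hvec]
      push_cast; rfl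
    have h := BenfordLinear.isBenford_norm_map_pow hb hA hres L
    simp only [hL, Complex.norm_real, Complex.ofReal_eq_zero] at h
    exact h.imp_left BenfordLinear.isBenford_norm_iff.1
  · let L : Matrix (Fin d) (Fin d) ℂ →ₗ[ℂ] EuclideanSpace ℂ (Fin d) :=
      { toFun := fun M => WithLp.toLp 2 (M.mulVec (fun i => (x i : ℂ)))
        map_add' := fun M N => by rw [Matrix.add_mulVec]; rfl
        map_smul' := fun c M => by rw [Matrix.smul_mulVec]; rfl }
    have hL : ∀ n, ‖L ((A ^ n).map (algebraMap ℝ ℂ))‖ =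
        BenfordLinear.euclideanNorm ((A ^ n).mulVec x) := by
      intro n
      simp only [L, LinearMap.coe_mk, AddHom.coe_mk, BenfordLinear.euclideanNorm,
        EuclideanSpace.norm_eq, hvec, Complex.norm_real]
    rcases BenfordLinear.isBenford_norm_map_pow hb hA hres L with h | h
    · simpa only [hL] using h
    -- At `n = 0` the power is the identity, so vanishing would force `x = 0`.
    · refine absurd ?_ hx
      have h0 := hL 0
      rw [h 0, norm_zero, pow_zero, Matrix.one_mulVec] at h0
      exact (WithLp.toLp_eq_zero 2).1 (norm_eq_zero.1 h0.symm)
  · let L : Matrix (Fin d) (Fin d) ℂ →ₗ[ℂ]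
        (EuclideanSpace ℂ (Fin d) →L[ℂ] EuclideanSpace ℂ (Fin d)) :=
      (Matrix.toEuclideanCLM (n := Fin d) (𝕜 := ℂ)).toAlgEquiv.toLinearMap
    have hL : ∀ n, ‖L ((A ^ n).map (algebraMap ℝ ℂ))‖ = BenfordLinear.matrixNorm (A ^ n) :=
      fun n => BenfordLinear.norm_toEuclideanCLM_map_ofReal (A ^ n)
    rcases BenfordLinear.isBenford_norm_map_pow hb hA hres L with h | h
    · simpa only [hL] using h
    -- Again `n = 0`: the identity has norm 1 because `d > 0`.
    · exfalso
      have h0 := hL 0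
      rw [h 0, norm_zero, pow_zero, BenfordLinear.matrixNorm, map_one] at h0
      have : Nonempty (Fin d) := ⟨⟨0, hd⟩⟩
      rw [norm_one] at h0
      exact zero_ne_one h0
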